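/- Let $\|\cdot\|$ be an arbitrary norm on $\mathbb{R}^m$, let $\Xi\subseteq\mathbb{R}^m$, let $\widehat\xi_1,\dots,\widehat\xi_N\in\Xi$ ($N\ge 1$) be data points with empirical distribution $\widehat{\mathbb{P}}_N=\frac1N\sum_{i=1}^N\delta_{\widehat\xi_i}$, and let $\ell=\max_{k\le K}\ell_k$ with $K\ge 1$ and $\ell_k:\mathbb{R}^m\to\overline{\mathbb{R}}=[-\infty,\infty]$. Let $\mathcal{M}(\Xi)$ be the set of probability distributions $\mathbb{Q}$ supported on $\Xi$ with $\mathbb{E}^{\mathbb{Q}}[\|\xi\|]<\infty$, let $$d_{\mathrm W}(\mathbb{Q}_1,\mathbb{Q}_2)=\inf\Big\{\int\|\xi_1-\xi_2\|\,\Pi(\mathrm d\xi_1,\mathrm d\xi_2)\;:\;\Pi\text{ has marginals }\mathbb{Q}_1,\mathbb{Q}_2\Big\}$$ be the Wasserstein distance, and for $\varepsilon\ge 0$ let $\mathbb{B}_\varepsilon(\widehat{\mathbb{P}}_N)=\{\mathbb{Q}\in\mathcal{M}(\Xi): d_{\mathrm W}(\widehat{\mathbb{P}}_N,\mathbb{Q})\le\varepsilon\}$.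 Expectations of extended-real-valued functions are defined by $\mathbb{E}^{\mathbb{Q}}[\ell]=\mathbb{E}^{\mathbb{Q}}[\max\{\ell,0\}]+\mathbb{E}^{\mathbb{Q}}[\min\{\ell,0\}]$ with $\infty-\infty=\infty$. Assume that $\Xi$ is convex and closed, that each $-\ell_k$ is proper (that is, $-\ell_k>-\infty$ everywhere and $-\ell_k<\infty$ somewhere), convex and lower semicontinuous, and that no $\ell_k$ is identically $-\infty$ on $\Xi$. Then, for every $\varepsilon\ge0$, the worst-case expectation $\sup_{\mathbb{Q}\in\mathbb{B}_\varepsilon(\widehat{\mathbb{P}}_N)}\mathbb{E}^{\mathbb{Q}}[\ell(\xi)]$ equals the optimal value of the finite program $$\begin{array}{cll}\displaystyle\sup_{\alpha_{ik}\in\mathbb{R},\,q_{ik}\in\mathbb{R}^m}&\displaystyle\frac1N\sum_{i=1}^N\sum_{k=1}^K\alpha_{ik}\,\ell_k\Big(\widehat\xi_i-\frac{q_{ik}}{\alpha_{ik}}\Big)\\ \text{s.t.}&\displaystyle\frac1N\sum_{i=1}^N\sum_{k=1}^K\|q_{ik}\|\le\varepsilon,\\ &\displaystyle\sum_{k=1}^K\alpha_{ik}=1&\forall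 i\le N,\\ &\alpha_{ik}\ge0&\forall i\le N,\ k\le K,\\ &\displaystyle\widehat\xi_i-\frac{q_{ik}}{\alpha_{ik}}\in\Xi&\forall i\le N,\ k\le K,\end{array}$$ which is convex (its feasible set is convex and its objective is concave on it). Here, for $\alpha_{ik}=0$, the last constraint means $q_{ik}=0$, one sets $q_{ik}/\alpha_{ik}=0/0=0$, and the $ik$-th term of the objective is $0$. Moreover, let $(\alpha_{ik}(r),q_{ik}(r))_{r\in\mathbb{N}}$ be a sequence of feasible points whose objective values converge (in $\overline{\mathbb{R}}$) to the supremum of this program, and put $\xi_{ik}(r)=\widehat\xi_i-q_{ik}(r)/\alpha_{ik}(r)$. Then the discrete probability distributions $\mathbb{Q}_r=\frac1N\sum_{i=1}^N\sum_{k=1}^K\alpha_{ik}(r)\,\delta_{\xi_{ik}(r)}$ belong to $\mathbb{B}_\varepsilon(\widehat{\mathbb{P}}_N)$ for all $r$, and $$\sup_{\mathbb{Q}\in\mathbb{B}_\varepsilon(\widehat{\mathbb{P}}_N)}\mathbb{E}^{\mathbb{Q}}[\ell(\xi)]=\lim_{r\to\infty}\mathbb{E}^{\mathbb{Q}_r}[\ell(\xi)]=\lim_{r\to\infty}\frac1N\sum_{i=1}^N\sum_{k=1}^K\alpha_{ik}(r)\,\ell(\xi_{ik}(r)),$$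 where terms with $\alpha_{ik}(r)=0$ count as $0$. -/

import Mathlib

open MeasureTheory Filter Topology
open scoped ENNReal

namespace WassersteinDRO

noncomputable section

/-- An extended-real-valued function is proper if it never takes the value `-∞` and is smaller
than `+∞` somewhere. -/
def IsProper {V : Type*} (f : V → EReal) : Prop :=
  (∃ x, f x < ⊤) ∧ ∀ x, ⊥ < f x

/-- Convexity on `S` of an extended-real-valued function: `S` and the epigraph of `f` over `S`
are convex. -/
def IsConvexFunOn {V : Type*} [AddCommMonoid V] [Module ℝ V] (S : Set V) (f : V → EReal) : Prop :=
  Convex ℝ S ∧ Convex ℝ {p : V × ℝ | p.1 ∈ S ∧ f p.1 ≤ (p.2 : EReal)}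

/-- The expectation `𝔼[max{f, 0}] + 𝔼[min{f, 0}]` of an extended-real-valued function, with the
convention `∞ - ∞ = ∞`. -/
def expect {E : Type*} [MeasurableSpace E] (Q : Measure E) (f : E → EReal) : EReal :=
  if ∫⁻ x, (f x).toENNReal ∂Q = ⊤ then ⊤
  else ((∫⁻ x, (f x).toENNReal ∂Q : ℝ≥0∞) : EReal) - ((∫⁻ x, (-f x).toENNReal ∂Q : ℝ≥0∞) : EReal)

/-- The pointwise maximum `ℓ(ξ) = max_k ℓ_k(ξ)`. -/
def maxLoss {E : Type*} {K : ℕ} (ℓ : Fin K → E → EReal) (ξ : E) : EReal :=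
  ⨆ k, ℓ k ξ

section Normed

variable {E : Type*} [NormedAddCommGroup E] [NormedSpace ℝ E]

/-- The convexity assumption: `Ξ` is convex and closed, every `-ℓ_k` is proper, convex and lower
semicontinuous, and no `ℓ_k` is identically `-∞` on `Ξ`. -/
structure ConvexityAssumption {K : ℕ} (Ξ : Set E) (ℓ : Fin K → E → EReal) : Prop where
  convex : Convex ℝ Ξ
  isClosed : IsClosed Ξ
  proper : ∀ k, IsProper fun ξ => -ℓ k ξ
  convexFun : ∀ k, IsConvexFunOn Set.univ fun ξ => -ℓ k ξ
  lsc : ∀ k, LowerSemicontinuous fun ξ => -ℓ k ξ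
  not_bot : ∀ k, ∃ ξ ∈ Ξ, ℓ k ξ ≠ ⊥

section Measures

variable [MeasurableSpace E]

/-- The space `𝓜(Ξ)` of probability distributions on `Ξ` with finite first moment. -/
def distributions (Ξ : Set E) : Set (Measure E) :=
  {Q | IsProbabilityMeasure Q ∧ Q Ξᶜ = 0 ∧ ∫⁻ ξ, ‖ξ‖ₑ ∂Q < ⊤}

/-- The (1-)Wasserstein distance: infimum of the transportation costs over all joint
distributions with the given marginals. -/
def wasserstein (Q₁ Q₂ : Measure E) : ℝ≥0∞ :=
  ⨅ (P : Measure (E × E)) (_ : P.map Prod.fst = Q₁ ∧ P.map Prod.snd = Q₂),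
    ∫⁻ p, ‖p.1 - p.2‖ₑ ∂P

/-- The Wasserstein ball of radius `ε` around `P` in `𝓜(Ξ)`. -/
def wassersteinBall (Ξ : Set E) (P : Measure E) (ε : ℝ) : Set (Measure E) :=
  {Q | Q ∈ distributions Ξ ∧ wasserstein P Q ≤ ENNReal.ofReal ε}

/-- The empirical distribution of the sample `ξhat`. -/
def empirical {N : ℕ} (ξhat : Fin N → E) : Measure E :=
  (N : ℝ≥0∞)⁻¹ • ∑ i, Measure.dirac (ξhat i)

/-- The worst-case expectation of `f` over a set of distributions. -/
def worstCaseExpectation (B : Set (Measure E)) (f : E → EReal) : EReal :=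
  ⨆ Q ∈ B, expect Q f

end Measures

/-- Decision variables `(α, q)`. -/
abbrev Decision (E : Type*) (N K : ℕ) : Type _ :=
  (Fin N → Fin K → ℝ) × (Fin N → Fin K → E)

/-- The point `ξ_ik = ξhat_i - q_ik / α_ik`. With `0⁻¹ = 0` it equals `ξhat_i` for
`α_ik = 0` and `q_ik = 0`, in accordance with `0 / 0 = 0`. -/
def atom {N K : ℕ} (ξhat : Fin N → E) (d : Decision E N K) (i : Fin N) (k : Fin K) : E :=
  ξhat i - (d.1 i k)⁻¹ • d.2 i k

/-- The feasible set of the finite program. If `α_ik = 0` and `q_ik ≠ 0` then `q_ik / α_ik` is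
infinite, so that `ξhat_i - q_ik / α_ik ∉ Ξ`; hence the last constraint includes
`α_ik = 0 → q_ik = 0`. -/
def feasibleSet {N : ℕ} (K : ℕ) (Ξ : Set E) (ξhat : Fin N → E) (ε : ℝ) : Set (Decision E N K) :=
  {d | (N : ℝ)⁻¹ * ∑ i, ∑ k, ‖d.2 i k‖ ≤ ε ∧
    (∀ i, ∑ k, d.1 i k = 1) ∧
    (∀ i k, 0 ≤ d.1 i k) ∧
    ∀ i k, (d.1 i k = 0 → d.2 i k = 0) ∧ atom ξhat d i k ∈ Ξ}

/-- The objective `(1/N) ∑_i ∑_k α_ik ℓ_k(ξhat_i - q_ik / α_ik)`, with `0 · (-∞) = 0`. -/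
def objective {N K : ℕ} (ξhat : Fin N → E) (ℓ : Fin K → E → EReal) (d : Decision E N K) : EReal :=
  (((N : ℝ)⁻¹ : ℝ) : EReal) * ∑ i, ∑ k, (d.1 i k : EReal) * ℓ k (atom ξhat d i k)

/-- The optimal value of the finite program. -/
def programValue {N K : ℕ} (Ξ : Set E) (ξhat : Fin N → E) (ℓ : Fin K → E → EReal) (ε : ℝ) :
    EReal :=
  ⨆ d ∈ feasibleSet K Ξ ξhat ε, objective ξhat ℓ d

/-- The discrete distribution `(1/N) ∑_i ∑_k α_ik δ_{ξ_ik}` induced by `(α, q)`. -/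
def inducedDistribution [MeasurableSpace E] {N K : ℕ} (ξhat : Fin N → E) (d : Decision E N K) :
    Measure E :=
  (N : ℝ≥0∞)⁻¹ • ∑ i, ∑ k, ENNReal.ofReal (d.1 i k) • Measure.dirac (atom ξhat d i k)

end Normed

end

end WassersteinDRO

/-!
Disintegrating an optimal transport plan from the empirical distribution to `Q` (one exists, the set
of couplings being compact by Prokhorov's theorem) writes `Q` as the uniform mixture of conditional
distributions `μ_i`. Cut the space into cells `A_k` on which `ℓ = ℓ_k` and replace the mass that
`μ_i` puts on `A_k` by an atom at its barycentre. By Jensen's inequality this does not decrease the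
expected loss, by the triangle inequality for integrals it does not increase the transport cost, and
the result is a feasible point of the finite program. Conversely, moving the mass `α_ik` of `ξhat_i`
to `ξ_ik` costs `‖q_ik‖`, so a feasible point induces a distribution in the ball, whose expected
loss is at least the objective because `ℓ_k ≤ ℓ`.
-/

namespace WassersteinDRO

section OptimalTransport

open ProbabilityTheory
open scoped NNReal BoundedContinuousFunction

theorem lowerSemicontinuous_lintegral {X : Type*} [TopologicalSpace X] [MeasurableSpace X]
    [OpensMeasurableSpace X] {c : X → ℝ≥0} (hc : Continuous c) :
    LowerSemicontinuous fun P : ProbabilityMeasure X => ∫⁻ x, c x ∂(P : Measure X) := by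
  let truncation (n : ℕ) : X →ᵇ ℝ≥0 :=
    BoundedContinuousFunction.mkOfBound ⟨fun x => min (c x) n, by fun_prop⟩ n fun _ _ =>
      abs_sub_le_of_nonneg_of_le (NNReal.coe_nonneg _) (NNReal.coe_le_coe.2 (min_le_right _ _))
        (NNReal.coe_nonneg _) (NNReal.coe_le_coe.2 (min_le_right _ _))
  have iSup_truncation (x : X) : (c x : ℝ≥0∞) = ⨆ n, (truncation n x : ℝ≥0∞) := by
    refine le_antisymm ?_ (iSup_le fun n => ENNReal.coe_le_coe.2 (min_le_left _ _))
    obtain ⟨n, hn⟩ := exists_nat_ge (c x)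
    exact le_iSup_of_le n (ENNReal.coe_le_coe.2 (le_min le_rfl hn))
  have lintegral_eq (P : ProbabilityMeasure X) :
      ∫⁻ x, c x ∂(P : Measure X) =
        ⨆ n, (P.toFiniteMeasure.testAgainstNN (truncation n) : ℝ≥0∞) := by
    simp only [iSup_truncation, FiniteMeasure.testAgainstNN_coe_eq]
    exact lintegral_iSup (fun n => (truncation n).continuous.measurable.coe_nnreal_ennreal)
      fun m n hmn x => ENNReal.coe_le_coe.2 (min_le_min_left _ (by exact_mod_cast hmn))
  simp only [lintegral_eq]
  exact lowerSemicontinuous_iSup fun n => (ENNReal.continuous_coe.comp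
    (ProbabilityMeasure.continuous_testAgainstNN_eval (truncation n))).lowerSemicontinuous

variable {X Y : Type*} [MeasurableSpace X] [MeasurableSpace Y]

/-- The couplings (transport plans) of two probability measures. -/
def couplings (μ : ProbabilityMeasure X) (ν : ProbabilityMeasure Y) :
    Set (ProbabilityMeasure (X × Y)) :=
  {P | P.map measurable_fst.aemeasurable = μ ∧ P.map measurable_snd.aemeasurable = ν}

theorem nonempty_couplings (μ : ProbabilityMeasure X) (ν : ProbabilityMeasure Y) :
    (couplings μ ν).Nonempty :=
  ⟨μ.prod ν, ProbabilityMeasure.map_fst_prod _ _, ProbabilityMeasure.map_snd_prod _ _⟩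

variable [TopologicalSpace X] [PolishSpace X] [BorelSpace X]
  [TopologicalSpace Y] [PolishSpace Y] [BorelSpace Y]

theorem isClosed_couplings (μ : ProbabilityMeasure X) (ν : ProbabilityMeasure Y) :
    IsClosed (couplings μ ν) :=
  (isClosed_eq (ProbabilityMeasure.continuous_map continuous_fst) continuous_const).inter
    (isClosed_eq (ProbabilityMeasure.continuous_map continuous_snd) continuous_const)

theorem isTightMeasureSet_couplings (μ : ProbabilityMeasure X) (ν : ProbabilityMeasure Y) :
    IsTightMeasureSet
      {((P : ProbabilityMeasure (X × Y)) : Measure (X × Y)) | P ∈ couplings μ ν} := by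
  refine .prodMk (isTightMeasureSet_singleton (μ := (μ : Measure X)) |>.subset ?_)
    (isTightMeasureSet_singleton (μ := (ν : Measure Y)) |>.subset ?_)
  · rintro _ ⟨_, ⟨P, hP, rfl⟩, rfl⟩
    simp [← hP.1, Measure.fst]
  · rintro _ ⟨_, ⟨P, hP, rfl⟩, rfl⟩
    simp [← hP.2, Measure.snd]

theorem isCompact_couplings (μ : ProbabilityMeasure X) (ν : ProbabilityMeasure Y) :
    IsCompact (couplings μ ν) := by
  simpa only [(isClosed_couplings μ ν).closure_eq] using
    isCompact_closure_of_isTightMeasureSet (isTightMeasureSet_couplings μ ν)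

theorem exists_isMinOn_couplings_lintegral (μ : ProbabilityMeasure X) (ν : ProbabilityMeasure Y)
    {c : X × Y → ℝ≥0} (hc : Continuous c) :
    ∃ P ∈ couplings μ ν,
      IsMinOn (fun P : ProbabilityMeasure (X × Y) => ∫⁻ p, c p ∂(P : Measure (X × Y)))
        (couplings μ ν) P :=
  ((lowerSemicontinuous_lintegral hc).lowerSemicontinuousOn _).exists_isMinOn
    (nonempty_couplings μ ν) (isCompact_couplings μ ν)

end OptimalTransport

section Wasserstein

variable {E : Type*} [NormedAddCommGroup E] [CompleteSpace E] [SecondCountableTopology E]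
  [MeasurableSpace E] [BorelSpace E]

theorem exists_coupling_lintegral_eq_wasserstein (Q₁ Q₂ : Measure E) [IsProbabilityMeasure Q₁]
    [IsProbabilityMeasure Q₂] :
    ∃ P : Measure (E × E), P.map Prod.fst = Q₁ ∧ P.map Prod.snd = Q₂ ∧
      ∫⁻ p, ‖p.1 - p.2‖ₑ ∂P = wasserstein Q₁ Q₂ := by
  obtain ⟨P, ⟨hP₁, hP₂⟩, hmin⟩ := exists_isMinOn_couplings_lintegral
    (⟨Q₁, ‹_›⟩ : ProbabilityMeasure E) (⟨Q₂, ‹_›⟩ : ProbabilityMeasure E)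
    (c := fun p => ‖p.1 - p.2‖₊) (by fun_prop)
  have hmap₁ : (P : Measure (E × E)).map Prod.fst = Q₁ := congrArg Subtype.val hP₁
  have hmap₂ : (P : Measure (E × E)).map Prod.snd = Q₂ := congrArg Subtype.val hP₂
  refine ⟨P, hmap₁, hmap₂, le_antisymm (le_iInf₂ fun P' hP' => ?_)
    (iInf₂_le (P : Measure (E × E)) ⟨hmap₁, hmap₂⟩)⟩
  have : IsProbabilityMeasure P' := by
    have : IsProbabilityMeasure (P'.map Prod.fst) := hP'.1 ▸ ‹_›
    exact Measure.isProbabilityMeasure_of_map Prod.fst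
  exact hmin (a := ⟨P', this⟩) ⟨Subtype.ext hP'.1, Subtype.ext hP'.2⟩

end Wasserstein

section UniformMixture

variable {X : Type*} [MeasurableSpace X] {N : ℕ}

/-- The uniform mixture `(1/N) ∑_i μ_i`. The empirical distribution and the distribution induced by
a decision are of this form, the mixture component `μ_i` carrying the mass moved out of `ξhat_i`. -/
noncomputable def uniformMixture (μ : Fin N → Measure X) : Measure X :=
  (N : ℝ≥0∞)⁻¹ • ∑ i, μ i

theorem lintegral_uniformMixture (μ : Fin N → Measure X) (f : X → ℝ≥0∞) :
    ∫⁻ x, f x ∂uniformMixture μ = (N : ℝ≥0∞)⁻¹ * ∑ i, ∫⁻ x, f x ∂μ i := by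
  rw [uniformMixture, lintegral_smul_measure, lintegral_finsetSum_measure, smul_eq_mul]

theorem isProbabilityMeasure_uniformMixture (hN : 0 < N) (μ : Fin N → Measure X)
    [∀ i, IsProbabilityMeasure (μ i)] : IsProbabilityMeasure (uniformMixture μ) :=
  ⟨by simp [uniformMixture, ENNReal.inv_mul_cancel, hN.ne']⟩

theorem map_uniformMixture {Y : Type*} [MeasurableSpace Y] (μ : Fin N → Measure X) {f : X → Y}
    (hf : Measurable f) : (uniformMixture μ).map f = uniformMixture fun i => (μ i).map f := by
  simp only [uniformMixture, ← Measure.mapₗ_apply_of_measurable hf, map_smul, map_sum]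

theorem absolutelyContinuous_uniformMixture (μ : Fin N → Measure X) (i : Fin N) :
    μ i ≪ uniformMixture μ := by
  refine Measure.AbsolutelyContinuous.mk fun s _ hs => ?_
  simp_all [uniformMixture]

theorem integrable_of_uniformMixture {F : Type*} [NormedAddCommGroup F] {μ : Fin N → Measure X}
    {f : X → F} (hf : Integrable f (uniformMixture μ)) (i : Fin N) : Integrable f (μ i) := by
  have hN : (N : ℝ≥0∞)⁻¹ ≠ 0 := by simp
  have hi := i.pos
  rw [uniformMixture, integrable_smul_measure hN (by simp [hi.ne'])] at hf
  exact integrable_finsetSum_measure.1 hf i (Finset.mem_univ i)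

theorem integral_uniformMixture {μ : Fin N → Measure X} {f : X → ℝ}
    (hf : ∀ i, Integrable f (μ i)) :
    ∫ x, f x ∂uniformMixture μ = (N : ℝ)⁻¹ * ∑ i, ∫ x, f x ∂μ i := by
  rw [uniformMixture, integral_smul_measure, integral_finsetSum_measure fun i _ => hf i]
  simp

end UniformMixture

section Decomposition

variable {X Y : Type*} [MeasurableSpace X] [MeasurableSpace Y] {N : ℕ}

theorem empirical_eq_uniformMixture_dirac (ξhat : Fin N → X) :
    empirical ξhat = uniformMixture fun i => Measure.dirac (ξhat i) :=
  rfl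

theorem map_fst_uniformMixture_map_prodMk (ξhat : Fin N → X) (μ : Fin N → Measure Y)
    [∀ i, IsProbabilityMeasure (μ i)] :
    (uniformMixture fun i => (μ i).map (Prod.mk (ξhat i))).map Prod.fst = empirical ξhat := by
  have hmap (i : Fin N) :
      ((μ i).map (Prod.mk (ξhat i))).map Prod.fst = Measure.dirac (ξhat i) := by
    rw [Measure.map_map measurable_fst measurable_prodMk_left]
    simp [Function.comp_def]
  simp only [map_uniformMixture _ measurable_fst, hmap, empirical_eq_uniformMixture_dirac]

theorem map_snd_uniformMixture_map_prodMk (ξhat : Fin N → X) (μ : Fin N → Measure Y) :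
    (uniformMixture fun i => (μ i).map (Prod.mk (ξhat i))).map Prod.snd = uniformMixture μ := by
  have hmap (i : Fin N) : ((μ i).map (Prod.mk (ξhat i))).map Prod.snd = μ i := by
    rw [Measure.map_map measurable_snd measurable_prodMk_left]
    exact Measure.map_id
  simp only [map_uniformMixture _ measurable_snd, hmap]

theorem exists_eq_uniformMixture_map_prodMk [MeasurableSingletonClass X]
    [StandardBorelSpace Y] [Nonempty Y] (hN : 0 < N) (ξhat : Fin N → X) {P : Measure (X × Y)}
    (hP : P.map Prod.fst = empirical ξhat) :
    ∃ μ : Fin N → Measure Y, (∀ i, IsProbabilityMeasure (μ i)) ∧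
      P = uniformMixture fun i => (μ i).map (Prod.mk (ξhat i)) := by
  rw [empirical_eq_uniformMixture_dirac] at hP
  have := isProbabilityMeasure_uniformMixture hN fun i => Measure.dirac (ξhat i)
  have : IsProbabilityMeasure (P.map Prod.fst) := by rwa [hP]
  have : IsProbabilityMeasure P := Measure.isProbabilityMeasure_of_map Prod.fst
  have disintegration := P.disintegrate P.condKernel
  rw [Measure.fst, hP] at disintegration
  refine ⟨fun i => P.condKernel (ξhat i), fun i => inferInstance, disintegration.symm.trans ?_⟩
  ext s hs
  rw [Measure.compProd_apply hs, lintegral_uniformMixture]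
  simp [uniformMixture, Measure.map_apply measurable_prodMk_left hs]

end Decomposition

section WassersteinToEmpirical

variable {E : Type*} [NormedAddCommGroup E] [MeasurableSpace E] [BorelSpace E]
  [SecondCountableTopology E] {N : ℕ}

theorem lintegral_enorm_sub_uniformMixture_map_prodMk (ξhat : Fin N → E)
    (μ : Fin N → Measure E) :
    ∫⁻ p, ‖p.1 - p.2‖ₑ ∂(uniformMixture fun i => (μ i).map (Prod.mk (ξhat i))) =
      (N : ℝ≥0∞)⁻¹ * ∑ i, ∫⁻ ξ, ‖ξhat i - ξ‖ₑ ∂μ i := by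
  rw [lintegral_uniformMixture]
  congr! 2 with i
  exact lintegral_map (by fun_prop) measurable_prodMk_left

theorem wasserstein_empirical_uniformMixture_le (ξhat : Fin N → E)
    (μ : Fin N → Measure E) [∀ i, IsProbabilityMeasure (μ i)] :
    wasserstein (empirical ξhat) (uniformMixture μ) ≤
      (N : ℝ≥0∞)⁻¹ * ∑ i, ∫⁻ ξ, ‖ξhat i - ξ‖ₑ ∂μ i := by
  rw [← lintegral_enorm_sub_uniformMixture_map_prodMk]
  exact iInf₂_le _
    ⟨map_fst_uniformMixture_map_prodMk ξhat μ, map_snd_uniformMixture_map_prodMk ξhat μ⟩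

theorem exists_uniformMixture_wasserstein_eq [CompleteSpace E]
    (hN : 0 < N) (ξhat : Fin N → E) (Q : Measure E) [IsProbabilityMeasure Q] :
    ∃ μ : Fin N → Measure E, (∀ i, IsProbabilityMeasure (μ i)) ∧ uniformMixture μ = Q ∧
      (N : ℝ≥0∞)⁻¹ * ∑ i, ∫⁻ ξ, ‖ξhat i - ξ‖ₑ ∂μ i = wasserstein (empirical ξhat) Q := by
  have : IsProbabilityMeasure (empirical ξhat) :=
    isProbabilityMeasure_uniformMixture hN fun i => Measure.dirac (ξhat i)
  obtain ⟨P, hfst, hsnd, hcost⟩ :=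
    exists_coupling_lintegral_eq_wasserstein (empirical ξhat) Q
  obtain ⟨μ, hμ, rfl⟩ := exists_eq_uniformMixture_map_prodMk hN ξhat hfst
  rw [map_snd_uniformMixture_map_prodMk] at hsnd
  rw [lintegral_enorm_sub_uniformMixture_map_prodMk] at hcost
  exact ⟨μ, hμ, hsnd, hcost⟩

end WassersteinToEmpirical

section Concavity

theorem ereal_coe_sum {ι : Type*} (s : Finset ι) (f : ι → ℝ) :
    ((∑ j ∈ s, f j : ℝ) : EReal) = ∑ j ∈ s, (f j : EReal) :=
  map_sum (⟨⟨(↑), EReal.coe_zero⟩, EReal.coe_add⟩ : ℝ →+ EReal) f s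

theorem ereal_coe_mul_sum {ι : Type*} (s : Finset ι) (f : ι → EReal) {c : ℝ} (hc : 0 ≤ c) :
    (c : EReal) * ∑ j ∈ s, f j = ∑ j ∈ s, (c : EReal) * f j := by
  let mulLeft : EReal →+ EReal :=
    { toFun := fun x => c * x
      map_zero' := mul_zero _
      map_add' :=
        EReal.left_distrib_of_nonneg_of_ne_top (by exact_mod_cast hc) (EReal.coe_ne_top c) }
  exact map_sum mulLeft f s

variable {V : Type*} {S T : Set V} {f : V → EReal}

/-- The part over `S` of the hypograph of `f`; as a subset of `V × ℝ`, it omits the points at which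
`f = -∞`. -/
def hypograph (S : Set V) (f : V → EReal) : Set (V × ℝ) :=
  {p | p.1 ∈ S ∧ (p.2 : EReal) ≤ f p.1}

theorem isClosed_hypograph [TopologicalSpace V] (hS : IsClosed S)
    (hf : LowerSemicontinuous fun x => -f x) : IsClosed (hypograph S f) := by
  have hepigraph : IsClosed {p : V × ℝ | -f p.1 ≤ ((-p.2 : ℝ) : EReal)} :=
    hf.isClosed_epigraph.preimage
      (continuous_fst.prodMk (continuous_coe_real_ereal.comp continuous_snd.neg))
  convert (hS.preimage continuous_fst).inter hepigraph using 1
  ext p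
  simp [hypograph]

theorem toReal_mem_hypograph {x : V} (hx : x ∈ S) (htop : f x ≠ ⊤) (hbot : f x ≠ ⊥) :
    (x, (f x).toReal) ∈ hypograph S f :=
  ⟨hx, (EReal.coe_toReal htop hbot).le⟩

variable [AddCommMonoid V] [Module ℝ V]

theorem IsConvexFunOn.mono (hf : IsConvexFunOn T f) (hST : S ⊆ T) (hS : Convex ℝ S) :
    IsConvexFunOn S f := by
  refine ⟨hS, ?_⟩
  have hinter : {p : V × ℝ | p.1 ∈ S ∧ f p.1 ≤ (p.2 : EReal)} =
      LinearMap.fst ℝ V ℝ ⁻¹' S ∩ {p : V × ℝ | p.1 ∈ T ∧ f p.1 ≤ (p.2 : EReal)} := by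
    ext p
    simpa using fun hp _ => hST hp
  rw [hinter]
  exact (hS.linear_preimage (LinearMap.fst ℝ V ℝ)).inter hf.2

theorem convex_hypograph (hf : IsConvexFunOn S fun x => -f x) : Convex ℝ (hypograph S f) := by
  rintro ⟨x, u⟩ ⟨hx, hu⟩ ⟨y, v⟩ ⟨hy, hv⟩ s t hs ht hst
  obtain ⟨hmem, hle⟩ := hf.2 (x := (x, -u)) ⟨hx, by simpa using hu⟩ (y := (y, -v))
    ⟨hy, by simpa using hv⟩ hs ht hst
  refine ⟨hmem, ?_⟩
  rwa [EReal.neg_le, ← EReal.coe_neg,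
    show -(s • (x, -u) + t • (y, -v)).2 = (s • (x, u) + t • (y, v)).2 by simp; ring] at hle

theorem IsConvexFunOn.mul_add_mul_le (hf : IsConvexFunOn S fun x => -f x)
    (htop : ∀ x ∈ S, f x ≠ ⊤) {x y : V} (hx : x ∈ S) (hy : y ∈ S) {s t : ℝ} (hs : 0 < s)
    (ht : 0 < t) (hst : s + t = 1) :
    (s : EReal) * f x + (t : EReal) * f y ≤ f (s • x + t • y) := by
  by_cases hx_bot : f x = ⊥
  · simp [hx_bot, EReal.coe_mul_bot_of_pos hs]
  by_cases hy_bot : f y = ⊥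
  · simp [hy_bot, EReal.coe_mul_bot_of_pos ht]
  have := (convex_hypograph hf (toReal_mem_hypograph hx (htop x hx) hx_bot)
    (toReal_mem_hypograph hy (htop y hy) hy_bot) hs.le ht.le hst).2
  simpa [EReal.coe_toReal (htop x hx) hx_bot, EReal.coe_toReal (htop y hy) hy_bot] using this

theorem isConvexFunOn_neg_of_mul_add_mul_le (hS : Convex ℝ S)
    (hf : ∀ x ∈ S, ∀ y ∈ S, ∀ s t : ℝ, 0 ≤ s → 0 ≤ t → s + t = 1 →
      (s : EReal) * f x + (t : EReal) * f y ≤ f (s • x + t • y)) :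
    IsConvexFunOn S fun x => -f x := by
  refine ⟨hS, ?_⟩
  rintro ⟨x, u⟩ ⟨hx, hu⟩ ⟨y, v⟩ ⟨hy, hv⟩ s t hs ht hst
  refine ⟨hS hx hy hs ht hst, ?_⟩
  rw [EReal.neg_le, ← EReal.coe_neg] at hu hv ⊢
  calc ((-(s • (x, u) + t • (y, v)).2 : ℝ) : EReal)
      = (s : EReal) * (-u : ℝ) + (t : EReal) * (-v : ℝ) := by
        norm_cast
        simp
        ring
    _ ≤ (s : EReal) * f x + (t : EReal) * f y := by gcongr
    _ ≤ f (s • x + t • y) := hf x hx y hy s t hs ht hst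

/-- Scaling by the total weight turns the concavity inequality into superadditivity of the
perspective function `(a, w) ↦ a * f (w / a)`. -/
theorem IsConvexFunOn.mul_add_mul_le_add_mul (hf : IsConvexFunOn S fun x => -f x)
    (htop : ∀ x ∈ S, f x ≠ ⊤) {x y : V} (hx : x ∈ S) (hy : y ∈ S) {a b : ℝ} (ha : 0 ≤ a)
    (hb : 0 ≤ b) (hab : a + b ≠ 0) :
    (a : EReal) * f x + (b : EReal) * f y ≤
      ((a + b : ℝ) : EReal) * f ((a / (a + b)) • x + (b / (a + b)) • y) := by
  rcases ha.eq_or_lt with rfl | ha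
  · have hb : b ≠ 0 := by simpa using hab
    simp [hb]
  rcases hb.eq_or_lt with rfl | hb
  · simp [ha.ne']
  have hab : 0 < a + b := add_pos ha hb
  have := hf.mul_add_mul_le htop hx hy (div_pos ha hab) (div_pos hb hab) (by field_simp)
  calc (a : EReal) * f x + (b : EReal) * f y
      = ((a + b : ℝ) : EReal) *
          (((a / (a + b) : ℝ) : EReal) * f x + ((b / (a + b) : ℝ) : EReal) * f y) := by
        rw [EReal.left_distrib_of_nonneg_of_ne_top (by exact_mod_cast hab.le)
          (EReal.coe_ne_top _), ← mul_assoc, ← mul_assoc, ← EReal.coe_mul, ← EReal.coe_mul,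
          mul_div_cancel₀ _ hab.ne', mul_div_cancel₀ _ hab.ne']
    _ ≤ _ := by gcongr

end Concavity

section Program

variable {E : Type*} [NormedAddCommGroup E] [NormedSpace ℝ E] {N K : ℕ} {Ξ : Set E}
  {ξhat : Fin N → E} {ε : ℝ} {ℓ : Fin K → E → EReal}

theorem smul_atom {d : Decision E N K} {i : Fin N} {k : Fin K} (hd : d.1 i k = 0 → d.2 i k = 0) :
    d.1 i k • atom ξhat d i k = d.1 i k • ξhat i - d.2 i k := by
  rcases eq_or_ne (d.1 i k) 0 with h | h
  · simp [h, hd h]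
  · rw [atom, smul_sub, smul_inv_smul₀ h]

theorem atom_convexCombo {d e : Decision E N K} {i : Fin N} {k : Fin K}
    (hd : d.1 i k = 0 → d.2 i k = 0) (he : e.1 i k = 0 → e.2 i k = 0) {s t : ℝ}
    (h : s * d.1 i k + t * e.1 i k ≠ 0) :
    atom ξhat (s • d + t • e) i k =
      (s * d.1 i k / (s * d.1 i k + t * e.1 i k)) • atom ξhat d i k +
        (t * e.1 i k / (s * d.1 i k + t * e.1 i k)) • atom ξhat e i k := by
  apply smul_right_injective E h
  have hcombo := smul_atom (ξhat := ξhat) (d := s • d + t • e) (i := i) (k := k)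
    fun h0 => absurd h0 h
  simp only [Prod.fst_add, Prod.snd_add, Prod.smul_fst, Prod.smul_snd, Pi.add_apply,
    Pi.smul_apply, smul_eq_mul] at hcombo
  simp only [hcombo, smul_add, smul_smul, mul_div_cancel₀ _ h]
  simp only [mul_smul, smul_atom hd, smul_atom he]
  module

theorem convex_feasibleSet (hΞ : Convex ℝ Ξ) (hξ : ∀ i, ξhat i ∈ Ξ) (ε : ℝ) :
    Convex ℝ (feasibleSet K Ξ ξhat ε) := by
  rintro d ⟨hd_budget, hd_sum, hd_nonneg, hd_atom⟩ e ⟨he_budget, he_sum, he_nonneg, he_atom⟩ s t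
    hs ht hst
  have hsd (i : Fin N) (k : Fin K) : 0 ≤ s * d.1 i k := mul_nonneg hs (hd_nonneg i k)
  have hte (i : Fin N) (k : Fin K) : 0 ≤ t * e.1 i k := mul_nonneg ht (he_nonneg i k)
  have hzero (i : Fin N) (k : Fin K) (h : s * d.1 i k + t * e.1 i k = 0) :
      s • d.2 i k + t • e.2 i k = 0 := by
    obtain ⟨h₁, h₂⟩ := (add_eq_zero_iff_of_nonneg (hsd i k) (hte i k)).1 h
    have hq : s • d.2 i k = 0 := by
      rcases mul_eq_zero.1 h₁ with h | h <;> simp [h, (hd_atom i k).1]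
    have hr : t • e.2 i k = 0 := by
      rcases mul_eq_zero.1 h₂ with h | h <;> simp [h, (he_atom i k).1]
    rw [hq, hr, add_zero]
  refine ⟨?_, fun i => ?_, fun i k => add_nonneg (hsd i k) (hte i k), fun i k => ⟨hzero i k, ?_⟩⟩
  · calc (N : ℝ)⁻¹ * ∑ i, ∑ k, ‖(s • d + t • e).2 i k‖
        ≤ (N : ℝ)⁻¹ * ∑ i, ∑ k, (s * ‖d.2 i k‖ + t * ‖e.2 i k‖) := by
          gcongr with i _ k _
          refine (norm_add_le _ _).trans_eq ?_
          simp [norm_smul, abs_of_nonneg hs, abs_of_nonneg ht]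
      _ = s * ((N : ℝ)⁻¹ * ∑ i, ∑ k, ‖d.2 i k‖) + t * ((N : ℝ)⁻¹ * ∑ i, ∑ k, ‖e.2 i k‖) := by
          simp only [Finset.sum_add_distrib, ← Finset.mul_sum]
          ring
      _ ≤ s * ε + t * ε := by gcongr
      _ = ε := by rw [← add_mul, hst, one_mul]
  · simp [Finset.sum_add_distrib, ← Finset.mul_sum, hd_sum i, he_sum i, hst]
  · by_cases h : s * d.1 i k + t * e.1 i k = 0
    · simpa [atom, hzero i k h] using hξ i
    · rw [atom_convexCombo (hd_atom i k).1 (he_atom i k).1 h]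
      have hpos := (add_nonneg (hsd i k) (hte i k)).lt_of_ne' h
      exact hΞ (hd_atom i k).2 (he_atom i k).2 (div_nonneg (hsd i k) hpos.le)
        (div_nonneg (hte i k) hpos.le) (by field_simp)

theorem objective_convexCombo_ge (hℓ : ∀ k, IsConvexFunOn Ξ fun ξ => -ℓ k ξ)
    (htop : ∀ k, ∀ ξ ∈ Ξ, ℓ k ξ ≠ ⊤) {d e : Decision E N K} (hd : d ∈ feasibleSet K Ξ ξhat ε)
    (he : e ∈ feasibleSet K Ξ ξhat ε) {s t : ℝ} (hs : 0 ≤ s) (ht : 0 ≤ t) :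
    (s : EReal) * objective ξhat ℓ d + (t : EReal) * objective ξhat ℓ e ≤
      objective ξhat ℓ (s • d + t • e) := by
  obtain ⟨-, -, hd_nonneg, hd_atom⟩ := hd
  obtain ⟨-, -, he_nonneg, he_atom⟩ := he
  have hterm (i : Fin N) (k : Fin K) :
      (s : EReal) * ((d.1 i k : EReal) * ℓ k (atom ξhat d i k)) +
        (t : EReal) * ((e.1 i k : EReal) * ℓ k (atom ξhat e i k)) ≤
      ((s • d + t • e).1 i k : EReal) * ℓ k (atom ξhat (s • d + t • e) i k) := by
    have hsd : 0 ≤ s * d.1 i k := mul_nonneg hs (hd_nonneg i k)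
    have hte : 0 ≤ t * e.1 i k := mul_nonneg ht (he_nonneg i k)
    simp only [← mul_assoc, ← EReal.coe_mul]
    by_cases h : s * d.1 i k + t * e.1 i k = 0
    · obtain ⟨hsd, hte⟩ := (add_eq_zero_iff_of_nonneg hsd hte).1 h
      simp [hsd, hte]
    · rw [atom_convexCombo (hd_atom i k).1 (he_atom i k).1 h]
      exact (hℓ k).mul_add_mul_le_add_mul (htop k) (hd_atom i k).2 (he_atom i k).2 hsd hte h
  have hN : (0 : ℝ) ≤ (N : ℝ)⁻¹ := by positivity
  simp only [objective, mul_left_comm _ (((N : ℝ)⁻¹ : ℝ) : EReal)]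
  rw [← EReal.left_distrib_of_nonneg_of_ne_top (by exact_mod_cast hN) (EReal.coe_ne_top _)]
  simp only [ereal_coe_mul_sum _ _ hs, ereal_coe_mul_sum _ _ ht, ← Finset.sum_add_distrib]
  gcongr with i _ k _
  exact hterm i k

theorem isConvexFunOn_neg_objective (hΞ : Convex ℝ Ξ) (hξ : ∀ i, ξhat i ∈ Ξ)
    (hℓ : ∀ k, IsConvexFunOn Ξ fun ξ => -ℓ k ξ) (htop : ∀ k, ∀ ξ ∈ Ξ, ℓ k ξ ≠ ⊤) (ε : ℝ) :
    IsConvexFunOn (feasibleSet K Ξ ξhat ε) fun d => -objective ξhat ℓ d :=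
  isConvexFunOn_neg_of_mul_add_mul_le (convex_feasibleSet hΞ hξ ε) fun _ hd _ he _ _ hs ht _ =>
    objective_convexCombo_ge hℓ htop hd he hs ht

end Program

section Expectation

variable {X : Type*} [MeasurableSpace X] {Q : Measure X} {f : X → EReal}

theorem expect_eq_sub (hpos : ∫⁻ x, (f x).toENNReal ∂Q ≠ ⊤) :
    expect Q f =
      ((∫⁻ x, (f x).toENNReal ∂Q : ℝ≥0∞) : EReal) - ((∫⁻ x, (-f x).toENNReal ∂Q : ℝ≥0∞) : EReal) :=
  if_neg hpos

theorem expect_eq_bot (hpos : ∫⁻ x, (f x).toENNReal ∂Q ≠ ⊤)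
    (hneg : ∫⁻ x, (-f x).toENNReal ∂Q = ⊤) : expect Q f = ⊥ := by
  rw [expect_eq_sub hpos, hneg, EReal.coe_ennreal_top, EReal.sub_top]

theorem toENNReal_sub_toENNReal_neg (x : EReal) :
    ((x.toENNReal : ℝ≥0∞) : EReal) - (((-x).toENNReal : ℝ≥0∞) : EReal) = x := by
  induction x with
  | bot => simp
  | top => simp
  | coe r =>
    rw [← EReal.coe_neg, EReal.real_coe_toENNReal, EReal.real_coe_toENNReal,
      EReal.coe_ennreal_ofReal, EReal.coe_ennreal_ofReal, ← EReal.coe_sub,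
      max_zero_sub_max_neg_zero_eq_self]

theorem expect_dirac [MeasurableSingletonClass X] (x : X) (f : X → EReal) :
    expect (Measure.dirac x) f = f x := by
  simp only [expect, lintegral_dirac]
  split_ifs with htop
  · exact (EReal.toENNReal_eq_top_iff.1 htop).symm
  · exact toENNReal_sub_toENNReal_neg _

theorem expect_ofReal_smul {a : ℝ} (ha : 0 ≤ a) (hpos : ∫⁻ x, (f x).toENNReal ∂Q ≠ ⊤) :
    expect (ENNReal.ofReal a • Q) f = a * expect Q f := by
  have hpos' : ∫⁻ x, (f x).toENNReal ∂(ENNReal.ofReal a • Q) ≠ ⊤ := by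
    rw [lintegral_smul_measure]
    exact ENNReal.mul_ne_top ENNReal.ofReal_ne_top hpos
  rw [expect_eq_sub hpos', expect_eq_sub hpos, sub_eq_add_neg (a := ((∫⁻ x, _ ∂Q : ℝ≥0∞) : EReal)),
    EReal.left_distrib_of_nonneg_of_ne_top (by exact_mod_cast ha) (EReal.coe_ne_top a)]
  simp only [lintegral_smul_measure, smul_eq_mul, EReal.coe_ennreal_mul, EReal.coe_ennreal_ofReal,
    max_eq_left ha, sub_eq_add_neg, mul_neg]

theorem expect_finsetSum {ι : Type*} (s : Finset ι) {μ : ι → Measure X}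
    (hpos : ∀ i ∈ s, ∫⁻ x, (f x).toENNReal ∂μ i ≠ ⊤) :
    expect (∑ i ∈ s, μ i) f = ∑ i ∈ s, expect (μ i) f := by
  classical
  induction s using Finset.induction_on with
  | empty => simp [expect]
  | insert i s hi ih =>
    rw [Finset.forall_mem_insert] at hpos
    have hpos_sum : ∫⁻ x, (f x).toENNReal ∂(∑ i ∈ s, μ i) ≠ ⊤ := by
      simpa [lintegral_finsetSum_measure, ENNReal.sum_eq_top] using hpos.2
    rw [Finset.sum_insert hi, Finset.sum_insert hi, ← ih hpos.2, expect_eq_sub hpos.1,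
      expect_eq_sub hpos_sum, expect_eq_sub]
    · simp only [lintegral_add_measure, EReal.coe_ennreal_add]
      exact EReal.add_sub_add_comm (.inl (EReal.coe_ennreal_ne_bot _))
        (.inr (EReal.coe_ennreal_ne_bot _))
    · rw [lintegral_add_measure]
      exact ENNReal.add_ne_top.2 ⟨hpos.1, hpos_sum⟩

theorem expect_uniformMixture {N : ℕ} (hN : 0 < N) {μ : Fin N → Measure X}
    (hpos : ∀ i, ∫⁻ x, (f x).toENNReal ∂μ i ≠ ⊤) :
    expect (uniformMixture μ) f = ((N : ℝ)⁻¹ : ℝ) * ∑ i, expect (μ i) f := by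
  have hN_inv : (N : ℝ≥0∞)⁻¹ = ENNReal.ofReal (N : ℝ)⁻¹ := by
    rw [ENNReal.ofReal_inv_of_pos (by positivity), ENNReal.ofReal_natCast]
  rw [uniformMixture, hN_inv, expect_ofReal_smul (by positivity),
    expect_finsetSum _ fun i _ => hpos i]
  simpa [lintegral_finsetSum_measure, ENNReal.sum_eq_top] using hpos

theorem ae_ne_bot_of_lintegral_neg_ne_top (hf : Measurable f)
    (hneg : ∫⁻ x, (-f x).toENNReal ∂Q ≠ ⊤) : ∀ᵐ x ∂Q, f x ≠ ⊥ := by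
  filter_upwards [ae_lt_top hf.neg.ereal_toENNReal hneg] with x hx hbot
  simp [hbot] at hx

theorem integrable_toReal_of_lintegral_ne_top (hf : Measurable f)
    (hpos : ∫⁻ x, (f x).toENNReal ∂Q ≠ ⊤) (hneg : ∫⁻ x, (-f x).toENNReal ∂Q ≠ ⊤) :
    Integrable (fun x => (f x).toReal) Q := by
  refine ⟨hf.ereal_toReal.aestronglyMeasurable, (lintegral_mono fun x => ?_).trans_lt
    (lintegral_add_left hf.ereal_toENNReal (fun x => (-f x).toENNReal) ▸
      ENNReal.add_lt_top.2 ⟨hpos.lt_top, hneg.lt_top⟩)⟩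
  change ‖(f x).toReal‖ₑ ≤ (f x).toENNReal + (-f x).toENNReal
  induction f x with
  | bot => simp
  | top => simp
  | coe r =>
    rw [← EReal.coe_neg, EReal.real_coe_toENNReal, EReal.real_coe_toENNReal, EReal.toReal_coe,
      Real.enorm_eq_ofReal_abs]
    rcases abs_choice r with h | h <;> rw [h]
    exacts [le_self_add, le_add_self]

theorem expect_eq_integral_toReal (hf : Measurable f) (htop : ∀ x, f x ≠ ⊤)
    (hpos : ∫⁻ x, (f x).toENNReal ∂Q ≠ ⊤) (hneg : ∫⁻ x, (-f x).toENNReal ∂Q ≠ ⊤) :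
    expect Q f = ((∫ x, (f x).toReal ∂Q : ℝ) : EReal) := by
  rw [expect_eq_sub hpos, integral_eq_lintegral_pos_part_sub_lintegral_neg_part
    (integrable_toReal_of_lintegral_ne_top hf hpos hneg)]
  have hpos_eq : ∫⁻ x, ENNReal.ofReal (f x).toReal ∂Q = ∫⁻ x, (f x).toENNReal ∂Q :=
    lintegral_congr fun x => (EReal.toENNReal_of_ne_top (htop x)).symm
  have hneg_eq : ∫⁻ x, ENNReal.ofReal (-(f x).toReal) ∂Q = ∫⁻ x, (-f x).toENNReal ∂Q := by
    refine lintegral_congr_ae ?_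
    filter_upwards [ae_ne_bot_of_lintegral_neg_ne_top hf hneg] with x hx
    rw [EReal.toENNReal_of_ne_top (by simpa using hx), EReal.toReal_neg_eq]
  rw [hpos_eq, hneg_eq, EReal.coe_sub]
  simp only [← EReal.toReal_coe_ennreal]
  rw [EReal.coe_toReal (by simpa using hpos) (EReal.coe_ennreal_ne_bot _),
    EReal.coe_toReal (by simpa using hneg) (EReal.coe_ennreal_ne_bot _)]

end Expectation

section Loss

variable {E : Type*} {K : ℕ} (ℓ : Fin K → E → EReal)

theorem le_maxLoss (k : Fin K) (x : E) : ℓ k x ≤ maxLoss ℓ x :=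
  le_iSup (fun k => ℓ k x) k

theorem exists_eq_maxLoss (hK : 0 < K) (x : E) : ∃ k, ℓ k x = maxLoss ℓ x :=
  have : Nonempty (Fin K) := ⟨⟨0, hK⟩⟩
  exists_eq_ciSup_of_finite

theorem toENNReal_maxLoss_le_sum (x : E) :
    (maxLoss ℓ x).toENNReal ≤ ∑ k, (ℓ k x).toENNReal := by
  rcases K.eq_zero_or_pos with rfl | hK
  · simp [maxLoss]
  · obtain ⟨k, hk⟩ := exists_eq_maxLoss ℓ hK x
    rw [← hk]
    exact Finset.single_le_sum (f := fun k => (ℓ k x).toENNReal) (fun _ _ => zero_le)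
      (Finset.mem_univ k)

theorem exists_measurable_partition_argmax [MeasurableSpace E] (hK : 0 < K)
    (hℓ : ∀ k, Measurable (ℓ k)) :
    ∃ A : Fin K → Set E, (∀ k, MeasurableSet (A k)) ∧ Pairwise (Function.onFun Disjoint A) ∧
      ⋃ k, A k = Set.univ ∧ ∀ k, ∀ x ∈ A k, ℓ k x = maxLoss ℓ x := by
  have hmeas (k : Fin K) : MeasurableSet {x | ℓ k x = maxLoss ℓ x} :=
    measurableSet_eq_fun (hℓ k) (.iSup hℓ)
  refine ⟨disjointed fun k => {x | ℓ k x = maxLoss ℓ x},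
    fun k => disjointedRec (p := MeasurableSet) (fun _ j ht => ht.diff (hmeas j)) (hmeas k),
    disjoint_disjointed _, ?_, fun k x hx => disjointed_subset _ k hx⟩
  rw [iUnion_disjointed]
  exact Set.iUnion_eq_univ_iff.2 (exists_eq_maxLoss ℓ hK)

end Loss

section AffineMajorant

variable {E : Type*} [NormedAddCommGroup E] [NormedSpace ℝ E]

theorem exists_affine_majorant {f : E → EReal} (hf : IsConvexFunOn Set.univ fun x => -f x)
    (hlsc : LowerSemicontinuous fun x => -f x) {x₀ : E} (htop : f x₀ ≠ ⊤) (hbot : f x₀ ≠ ⊥) :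
    ∃ (φ : StrongDual ℝ E) (c : ℝ), ∀ x, f x ≤ ((φ x + c : ℝ) : EReal) := by
  have hnot_mem : (x₀, (f x₀).toReal + 1) ∉ hypograph Set.univ f := by
    rintro ⟨-, hle⟩
    have := EReal.toReal_le_toReal hle (EReal.coe_ne_bot _) htop
    rw [EReal.toReal_coe] at this
    linarith
  obtain ⟨g, u, hgu, hug⟩ := geometric_hahn_banach_point_closed
    (convex_hypograph hf) (isClosed_hypograph isClosed_univ hlsc) hnot_mem
  have g_apply (x : E) (t : ℝ) : g (x, t) = g (x, 0) + t * g (0, 1) := by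
    rw [← smul_eq_mul, ← map_smul, ← map_add]
    simp
  have hslope : g (0, 1) < 0 := by
    have := hgu.trans (hug _ (toReal_mem_hypograph (Set.mem_univ x₀) htop hbot))
    rw [g_apply, g_apply x₀ (f x₀).toReal] at this
    linarith
  refine ⟨-(g (0, 1))⁻¹ • g.comp (ContinuousLinearMap.inl ℝ E ℝ), (g (0, 1))⁻¹ * u, fun x =>
    EReal.ge_of_forall_gt_iff_ge.1 fun t ht => ?_⟩
  have hu : u - g (x, 0) < t * g (0, 1) := by
    have := hug (x, t) ⟨Set.mem_univ x, ht.le⟩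
    rw [g_apply] at this
    linarith
  have ht_lt := (lt_div_iff_of_neg hslope).2 hu
  rw [EReal.coe_le_coe_iff]
  refine ht_lt.le.trans_eq ?_
  simp [div_eq_inv_mul]
  ring

theorem lintegral_toENNReal_ne_top_of_concave [MeasurableSpace E] {f : E → EReal}
    (hf : IsConvexFunOn Set.univ fun x => -f x) (hlsc : LowerSemicontinuous fun x => -f x)
    {x₀ : E} (htop : f x₀ ≠ ⊤) (hbot : f x₀ ≠ ⊥) {Q : Measure E} [IsFiniteMeasure Q]
    (hQ : Integrable (fun x => x) Q) : ∫⁻ x, (f x).toENNReal ∂Q ≠ ⊤ := by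
  obtain ⟨φ, c, hle⟩ := exists_affine_majorant hf hlsc htop hbot
  have hint : Integrable (fun x => φ x + c) Q := (φ.integrable_comp hQ).add (integrable_const c)
  refine ((lintegral_mono fun x => ?_).trans_lt hint.2).ne
  refine (EReal.toENNReal_le_toENNReal (hle x)).trans ?_
  rw [EReal.real_coe_toENNReal]
  exact Real.ofReal_le_enorm _

end AffineMajorant

section ConvexityAssumption

variable {E : Type*} [NormedAddCommGroup E] [NormedSpace ℝ E] {K : ℕ} {Ξ : Set E}
  {ℓ : Fin K → E → EReal}

namespace ConvexityAssumption

theorem ne_top (hℓ : ConvexityAssumption Ξ ℓ) (k : Fin K) (x : E) : ℓ k x ≠ ⊤ := by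
  simpa using ((hℓ.proper k).2 x).ne'

theorem isConvexFunOn (hℓ : ConvexityAssumption Ξ ℓ) (k : Fin K) :
    IsConvexFunOn Ξ fun x => -ℓ k x :=
  (hℓ.convexFun k).mono (Set.subset_univ Ξ) hℓ.convex

theorem maxLoss_ne_top (hℓ : ConvexityAssumption Ξ ℓ) (x : E) : maxLoss ℓ x ≠ ⊤ := by
  rw [maxLoss, ← Finset.sup_univ_eq_iSup]
  exact ((Finset.sup_lt_iff bot_lt_top).2 fun k _ => (hℓ.ne_top k x).lt_top).ne

variable [MeasurableSpace E]

theorem measurable [BorelSpace E] (hℓ : ConvexityAssumption Ξ ℓ) (k : Fin K) :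
    Measurable (ℓ k) := by
  have h : Measurable fun x => - -ℓ k x := (hℓ.lsc k).measurable.neg
  simpa only [neg_neg] using h

theorem measurable_maxLoss [BorelSpace E] (hℓ : ConvexityAssumption Ξ ℓ) :
    Measurable (maxLoss ℓ) :=
  .iSup hℓ.measurable

theorem lintegral_maxLoss_ne_top [BorelSpace E] (hℓ : ConvexityAssumption Ξ ℓ) {Q : Measure E}
    [IsFiniteMeasure Q] (hQ : Integrable (fun x => x) Q) :
    ∫⁻ x, (maxLoss ℓ x).toENNReal ∂Q ≠ ⊤ := by
  refine ne_top_of_le_ne_top ?_ (lintegral_mono (toENNReal_maxLoss_le_sum ℓ))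
  rw [lintegral_finsetSum _ fun k _ => (hℓ.measurable k).ereal_toENNReal]
  refine ENNReal.sum_ne_top.2 fun k _ => ?_
  obtain ⟨x₀, -, hx₀⟩ := hℓ.not_bot k
  exact lintegral_toENNReal_ne_top_of_concave (hℓ.convexFun k) (hℓ.lsc k) (hℓ.ne_top k x₀) hx₀ hQ

end ConvexityAssumption

end ConvexityAssumption

section InducedDistribution

variable {E : Type*} [NormedAddCommGroup E] [NormedSpace ℝ E]
  {N K : ℕ} {Ξ : Set E} (ξhat : Fin N → E) {d : Decision E N K} {ε : ℝ}

theorem ofReal_inv_mul_sum_norm {F : Type*} [SeminormedAddCommGroup F] (hN : 0 < N)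
    (q : Fin N → Fin K → F) :
    ENNReal.ofReal ((N : ℝ)⁻¹ * ∑ i, ∑ k, ‖q i k‖) = (N : ℝ≥0∞)⁻¹ * ∑ i, ∑ k, ‖q i k‖ₑ := by
  rw [ENNReal.ofReal_mul (by positivity), ENNReal.ofReal_inv_of_pos (by positivity),
    ENNReal.ofReal_natCast, ENNReal.ofReal_sum_of_nonneg fun i _ => by positivity]
  simp only [ENNReal.ofReal_sum_of_nonneg fun k _ => norm_nonneg (q _ k), ofReal_norm]

theorem ofReal_mul_enorm_sub_atom {i : Fin N} {k : Fin K} (hα : 0 ≤ d.1 i k)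
    (hd : d.1 i k = 0 → d.2 i k = 0) :
    ENNReal.ofReal (d.1 i k) * ‖ξhat i - atom ξhat d i k‖ₑ = ‖d.2 i k‖ₑ := by
  rw [← Real.enorm_of_nonneg hα, ← enorm_smul, smul_sub, smul_atom hd, sub_sub_cancel]

variable [MeasurableSpace E]

/-- The distribution `∑_k α_ik δ_{ξ_ik}` into which a decision moves the mass of the atom
`ξhat_i`; the induced distribution is the uniform mixture of these over `i`. -/
noncomputable def conditionalDistribution (d : Decision E N K) (i : Fin N) : Measure E :=
  ∑ k, ENNReal.ofReal (d.1 i k) • Measure.dirac (atom ξhat d i k)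

theorem inducedDistribution_eq_uniformMixture (d : Decision E N K) :
    inducedDistribution ξhat d = uniformMixture (conditionalDistribution ξhat d) :=
  rfl

theorem isProbabilityMeasure_conditionalDistribution {i : Fin N} (hα : ∀ k, 0 ≤ d.1 i k)
    (hsum : ∑ k, d.1 i k = 1) : IsProbabilityMeasure (conditionalDistribution ξhat d i) := by
  refine ⟨?_⟩
  simp [conditionalDistribution, ← ENNReal.ofReal_sum_of_nonneg fun k _ => hα k, hsum]

variable [MeasurableSingletonClass E]

theorem lintegral_conditionalDistribution (d : Decision E N K) (i : Fin N) (f : E → ℝ≥0∞) :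
    ∫⁻ ξ, f ξ ∂conditionalDistribution ξhat d i =
      ∑ k, ENNReal.ofReal (d.1 i k) * f (atom ξhat d i k) := by
  simp [conditionalDistribution, lintegral_finsetSum_measure]

theorem expect_conditionalDistribution {i : Fin N} (hα : ∀ k, 0 ≤ d.1 i k) {f : E → EReal}
    (hf : ∀ k, f (atom ξhat d i k) ≠ ⊤) :
    expect (conditionalDistribution ξhat d i) f =
      ∑ k, (d.1 i k : EReal) * f (atom ξhat d i k) := by
  have hpos (k : Fin K) : ∫⁻ ξ, (f ξ).toENNReal ∂Measure.dirac (atom ξhat d i k) ≠ ⊤ := by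
    simpa using hf k
  rw [conditionalDistribution, expect_finsetSum]
  · simp only [expect_ofReal_smul (hα _) (hpos _), expect_dirac]
  · intro k _
    rw [lintegral_smul_measure]
    exact ENNReal.mul_ne_top ENNReal.ofReal_ne_top (hpos k)

theorem expect_inducedDistribution (hN : 0 < N) (hα : ∀ i k, 0 ≤ d.1 i k) {f : E → EReal}
    (hf : ∀ i k, f (atom ξhat d i k) ≠ ⊤) :
    expect (inducedDistribution ξhat d) f =
      ((N : ℝ)⁻¹ : ℝ) * ∑ i, ∑ k, (d.1 i k : EReal) * f (atom ξhat d i k) := by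
  rw [inducedDistribution_eq_uniformMixture, expect_uniformMixture hN]
  · simp only [expect_conditionalDistribution ξhat (hα _) (hf _)]
  · intro i
    rw [lintegral_conditionalDistribution]
    exact ENNReal.sum_ne_top.2 fun k _ =>
      ENNReal.mul_ne_top ENNReal.ofReal_ne_top (EReal.toENNReal_ne_top_iff.2 (hf i k))

theorem objective_le_expect_inducedDistribution (hN : 0 < N) (hα : ∀ i k, 0 ≤ d.1 i k)
    {ℓ : Fin K → E → EReal} (hℓ : ∀ i k, maxLoss ℓ (atom ξhat d i k) ≠ ⊤) :
    objective ξhat ℓ d ≤ expect (inducedDistribution ξhat d) (maxLoss ℓ) := by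
  rw [expect_inducedDistribution ξhat hN hα hℓ, objective]
  refine mul_le_mul_of_nonneg_left (Finset.sum_le_sum fun i _ => Finset.sum_le_sum fun k _ => ?_)
    (EReal.coe_nonneg.2 (by positivity))
  exact mul_le_mul_of_nonneg_left (le_maxLoss ℓ k _) (EReal.coe_nonneg.2 (hα i k))

theorem inducedDistribution_mem_distributions (hN : 0 < N) (hd : d ∈ feasibleSet K Ξ ξhat ε) :
    inducedDistribution ξhat d ∈ distributions Ξ := by
  obtain ⟨-, hsum, hα, hatom⟩ := hd
  have hprob (i : Fin N) := isProbabilityMeasure_conditionalDistribution ξhat (hα i) (hsum i)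
  refine ⟨isProbabilityMeasure_uniformMixture hN (conditionalDistribution ξhat d), ?_, ?_⟩
  · simp [inducedDistribution, (hatom _ _).2]
  · rw [inducedDistribution_eq_uniformMixture, lintegral_uniformMixture]
    simp only [lintegral_conditionalDistribution]
    have hN_inv : (N : ℝ≥0∞)⁻¹ < ⊤ := by simpa using hN
    exact ENNReal.mul_lt_top hN_inv <| ENNReal.sum_lt_top.2 fun i _ => ENNReal.sum_lt_top.2
      fun k _ => ENNReal.mul_lt_top ENNReal.ofReal_lt_top enorm_lt_top

theorem inducedDistribution_mem_wassersteinBall [BorelSpace E] [SecondCountableTopology E]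
    (hN : 0 < N) (hd : d ∈ feasibleSet K Ξ ξhat ε) :
    inducedDistribution ξhat d ∈ wassersteinBall Ξ (empirical ξhat) ε := by
  refine ⟨inducedDistribution_mem_distributions ξhat hN hd, ?_⟩
  obtain ⟨hbudget, hsum, hα, hatom⟩ := hd
  have hprob (i : Fin N) := isProbabilityMeasure_conditionalDistribution ξhat (hα i) (hsum i)
  calc wasserstein (empirical ξhat) (inducedDistribution ξhat d)
      ≤ (N : ℝ≥0∞)⁻¹ * ∑ i, ∫⁻ ξ, ‖ξhat i - ξ‖ₑ ∂conditionalDistribution ξhat d i :=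
        wasserstein_empirical_uniformMixture_le ξhat (conditionalDistribution ξhat d)
    _ = (N : ℝ≥0∞)⁻¹ * ∑ i, ∑ k, ‖d.2 i k‖ₑ := by
        simp only [lintegral_conditionalDistribution,
          ofReal_mul_enorm_sub_atom ξhat (hα _ _) (hatom _ _).1]
    _ = ENNReal.ofReal ((N : ℝ)⁻¹ * ∑ i, ∑ k, ‖d.2 i k‖) := (ofReal_inv_mul_sum_norm hN _).symm
    _ ≤ ENNReal.ofReal ε := ENNReal.ofReal_le_ofReal hbudget

end InducedDistribution

section CellDecision

theorem sum_enorm_setIntegral_le {X F ι : Type*} [MeasurableSpace X] [NormedAddCommGroup F]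
    [NormedSpace ℝ F] [Fintype ι] {ν : Measure X} {B : ι → Set X}
    (hB : ∀ k, MeasurableSet (B k)) (hdisj : Pairwise (Function.onFun Disjoint B))
    (f : X → F) : ∑ k, ‖∫ x in B k, f x ∂ν‖ₑ ≤ ∫⁻ x, ‖f x‖ₑ ∂ν :=
  calc ∑ k, ‖∫ x in B k, f x ∂ν‖ₑ
      ≤ ∑ k, ∫⁻ x in B k, ‖f x‖ₑ ∂ν :=
        Finset.sum_le_sum fun k _ => enorm_integral_le_lintegral_enorm _
    _ = ∫⁻ x in ⋃ k, B k, ‖f x‖ₑ ∂ν := by rw [lintegral_iUnion hB hdisj, tsum_fintype]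
    _ ≤ ∫⁻ x, ‖f x‖ₑ ∂ν := setLIntegral_le_lintegral _ _

variable {E : Type*} [NormedAddCommGroup E] [NormedSpace ℝ E] [MeasurableSpace E] {N K : ℕ}
  {Ξ : Set E} {ξhat : Fin N → E} {μ : Fin N → Measure E} {A : Fin K → Set E} {ε : ℝ}

/-- The decision that moves from `ξhat_i` to the barycentre of each cell `A_k` under `μ_i` the mass
`μ_i(A_k)` of that cell. -/
noncomputable def cellDecision (ξhat : Fin N → E) (μ : Fin N → Measure E) (A : Fin K → Set E) :
    Decision E N K :=
  (fun i k => (μ i).real (A k), fun i k => ∫ x in A k, (ξhat i - x) ∂μ i)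

theorem cellDecision_snd_eq_zero [∀ i, IsFiniteMeasure (μ i)] {i : Fin N} {k : Fin K}
    (h : (cellDecision ξhat μ A).1 i k = 0) : (cellDecision ξhat μ A).2 i k = 0 :=
  setIntegral_measure_zero _ ((measureReal_eq_zero_iff).1 h)

theorem atom_cellDecision [CompleteSpace E] [∀ i, IsFiniteMeasure (μ i)]
    {i : Fin N} {k : Fin K} (hint : Integrable (fun x => x) (μ i))
    (h : (μ i).real (A k) ≠ 0) : atom ξhat (cellDecision ξhat μ A) i k = ⨍ x in A k, x ∂μ i := by
  change ξhat i - ((μ i).real (A k))⁻¹ • ∫ x in A k, (ξhat i - x) ∂μ i = _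
  rw [integral_sub (integrable_const _) hint.integrableOn,
    setIntegral_const, smul_sub, inv_smul_smul₀ h, sub_sub_cancel, setAverage_eq]

theorem atom_cellDecision_mem [CompleteSpace E] [∀ i, IsFiniteMeasure (μ i)]
    (hΞ : Convex ℝ Ξ) (hΞ_closed : IsClosed Ξ) {i : Fin N} (hξ : ξhat i ∈ Ξ)
    (hint : Integrable (fun x => x) (μ i)) (hmem : ∀ᵐ x ∂μ i, x ∈ Ξ) (k : Fin K) :
    atom ξhat (cellDecision ξhat μ A) i k ∈ Ξ := by
  by_cases hα : (μ i).real (A k) = 0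
  · rw [atom, cellDecision_snd_eq_zero hα, smul_zero, sub_zero]
    exact hξ
  · rw [atom_cellDecision hint hα]
    exact hΞ.set_average_mem hΞ_closed ((measureReal_ne_zero_iff).1 hα) (measure_ne_top _ _)
      (ae_restrict_of_ae hmem) hint.integrableOn

theorem cellDecision_mem_feasibleSet [CompleteSpace E] [∀ i, IsProbabilityMeasure (μ i)]
    (hN : 0 < N) (hΞ : Convex ℝ Ξ) (hΞ_closed : IsClosed Ξ) (hξ : ∀ i, ξhat i ∈ Ξ)
    (hint : ∀ i, Integrable (fun x => x) (μ i)) (hmem : ∀ i, ∀ᵐ x ∂μ i, x ∈ Ξ)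
    (hA : ∀ k, MeasurableSet (A k)) (hdisj : Pairwise (Function.onFun Disjoint A))
    (hcover : ⋃ k, A k = Set.univ) (hε : 0 ≤ ε)
    (hcost : (N : ℝ≥0∞)⁻¹ * ∑ i, ∫⁻ x, ‖ξhat i - x‖ₑ ∂μ i ≤ ENNReal.ofReal ε) :
    cellDecision ξhat μ A ∈ feasibleSet K Ξ ξhat ε := by
  refine ⟨?_, fun i => ?_, fun i k => measureReal_nonneg, fun i k =>
    ⟨cellDecision_snd_eq_zero, atom_cellDecision_mem hΞ hΞ_closed (hξ i) (hint i) (hmem i) k⟩⟩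
  · rw [← ENNReal.ofReal_le_ofReal_iff hε, ofReal_inv_mul_sum_norm hN]
    refine le_trans ?_ hcost
    gcongr with i
    exact sum_enorm_setIntegral_le hA hdisj fun x => ξhat i - x
  · change ∑ k, (μ i).real (A k) = 1
    rw [← measureReal_iUnion_fintype hdisj hA, hcover, probReal_univ]

end CellDecision

section Jensen

variable {E : Type*} [NormedAddCommGroup E] [NormedSpace ℝ E] [CompleteSpace E]
  [MeasurableSpace E] {Ξ A : Set E} {f : E → EReal} {g : E → ℝ} {ν : Measure E}

theorem setAverage_le_of_concave (hf : IsConvexFunOn Ξ fun x => -f x) (hΞ : IsClosed Ξ)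
    (hlsc : LowerSemicontinuous fun x => -f x) (hA : ν A ≠ 0) (hA_top : ν A ≠ ⊤)
    (hint : IntegrableOn (fun x => x) A ν) (hg : IntegrableOn g A ν)
    (hmem : ∀ᵐ x ∂ν.restrict A, x ∈ Ξ) (hle : ∀ᵐ x ∂ν.restrict A, (g x : EReal) ≤ f x) :
    ((⨍ x in A, g x ∂ν : ℝ) : EReal) ≤ f (⨍ x in A, x ∂ν) := by
  have hgraph : ∀ᵐ x ∂ν.restrict A, (x, g x) ∈ hypograph Ξ f := hmem.and hle
  have := (convex_hypograph hf).set_average_mem (isClosed_hypograph hΞ hlsc) hA hA_top hgraph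
    (hint.prodMk hg)
  rw [average_pair hint hg] at this
  exact this.2

end Jensen

section ObjectiveOfCells

variable {E : Type*} [NormedAddCommGroup E] [NormedSpace ℝ E] [CompleteSpace E]
  [MeasurableSpace E] {N K : ℕ} {Ξ : Set E} {ξhat : Fin N → E} {ℓ : Fin K → E → EReal}
  {μ : Fin N → Measure E} [∀ i, IsFiniteMeasure (μ i)] {A : Fin K → Set E} {g : E → ℝ}

theorem setIntegral_le_mul_atom_cellDecision {f : E → EReal} (hf : IsConvexFunOn Ξ fun x => -f x)
    (hΞ : IsClosed Ξ) (hlsc : LowerSemicontinuous fun x => -f x)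
    {i : Fin N} {k : Fin K} (hint : Integrable (fun x => x) (μ i)) (hA : MeasurableSet (A k))
    (hmem : ∀ᵐ x ∂μ i, x ∈ Ξ) (hg : Integrable g (μ i))
    (hle : ∀ᵐ x ∂μ i, x ∈ A k → (g x : EReal) ≤ f x) :
    ((∫ x in A k, g x ∂μ i : ℝ) : EReal) ≤
      ((cellDecision ξhat μ A).1 i k : EReal) * f (atom ξhat (cellDecision ξhat μ A) i k) := by
  change _ ≤ ((μ i).real (A k) : EReal) * _
  by_cases hα : (μ i).real (A k) = 0
  · rw [hα, setIntegral_measure_zero _ ((measureReal_eq_zero_iff).1 hα), EReal.coe_zero, zero_mul]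
  · rw [← measure_smul_setAverage g (measure_ne_top _ _), smul_eq_mul, EReal.coe_mul,
      atom_cellDecision hint hα]
    exact mul_le_mul_of_nonneg_left
      (setAverage_le_of_concave hf hΞ hlsc
        ((measureReal_ne_zero_iff).1 hα) (measure_ne_top _ _) hint.integrableOn hg.integrableOn
        (ae_restrict_of_ae hmem) ((ae_restrict_iff' hA).2 hle))
      (EReal.coe_nonneg.2 measureReal_nonneg)

theorem integral_uniformMixture_le_objective_cellDecision
    (hℓ : ∀ k, IsConvexFunOn Ξ fun x => -ℓ k x) (hΞ : IsClosed Ξ)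
    (hlsc : ∀ k, LowerSemicontinuous fun x => -ℓ k x)
    (hint : ∀ i, Integrable (fun x => x) (μ i)) (hA : ∀ k, MeasurableSet (A k))
    (hdisj : Pairwise (Function.onFun Disjoint A)) (hcover : ⋃ k, A k = Set.univ)
    (hmem : ∀ i, ∀ᵐ x ∂μ i, x ∈ Ξ) (hg : ∀ i, Integrable g (μ i))
    (hle : ∀ i k, ∀ᵐ x ∂μ i, x ∈ A k → (g x : EReal) ≤ ℓ k x) :
    ((∫ x, g x ∂uniformMixture μ : ℝ) : EReal) ≤ objective ξhat ℓ (cellDecision ξhat μ A) := by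
  have hcells (i : Fin N) : ∫ x, g x ∂μ i = ∑ k, ∫ x in A k, g x ∂μ i := by
    rw [← integral_iUnion_fintype hA hdisj fun k => (hg i).integrableOn, hcover, setIntegral_univ]
  rw [integral_uniformMixture hg, EReal.coe_mul, objective]
  simp only [hcells, ereal_coe_sum]
  exact mul_le_mul_of_nonneg_left (Finset.sum_le_sum fun i _ => Finset.sum_le_sum fun k _ =>
    setIntegral_le_mul_atom_cellDecision (hℓ k) hΞ (hlsc k) (hint i) (hA k) (hmem i) (hg i)
      (hle i k)) (EReal.coe_nonneg.2 (by positivity))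

end ObjectiveOfCells

section UpperBound

variable {E : Type*} [NormedAddCommGroup E] [NormedSpace ℝ E] [CompleteSpace E]
  [MeasurableSpace E] {N K : ℕ} {Ξ : Set E} {ξhat : Fin N → E} {ℓ : Fin K → E → EReal} {ε : ℝ}
  [BorelSpace E] [SecondCountableTopology E]

theorem expect_maxLoss_le_programValue (hN : 0 < N) (hK : 0 < K) (hξ : ∀ i, ξhat i ∈ Ξ)
    (hℓ : ConvexityAssumption Ξ ℓ) (hε : 0 ≤ ε) {Q : Measure E}
    (hQ : Q ∈ wassersteinBall Ξ (empirical ξhat) ε) :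
    expect Q (maxLoss ℓ) ≤ programValue Ξ ξhat ℓ ε := by
  obtain ⟨⟨hprob, hsupp, hmoment⟩, hdist⟩ := hQ
  obtain ⟨μ, hμ, rfl, hcost⟩ := exists_uniformMixture_wasserstein_eq hN ξhat Q
  have hint : Integrable (fun x => x) (uniformMixture μ) :=
    ⟨measurable_id.aestronglyMeasurable, hmoment⟩
  have hpos := hℓ.lintegral_maxLoss_ne_top hint
  by_cases hneg : ∫⁻ x, (-maxLoss ℓ x).toENNReal ∂uniformMixture μ = ⊤
  · rw [expect_eq_bot hpos hneg]
    exact bot_le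
  obtain ⟨A, hA, hdisj, hcover, hargmax⟩ := exists_measurable_partition_argmax ℓ hK hℓ.measurable
  have hint_i := integrable_of_uniformMixture hint
  have hmem (i : Fin N) : ∀ᵐ x ∂μ i, x ∈ Ξ := absolutelyContinuous_uniformMixture μ i hsupp
  have hloss := integrable_toReal_of_lintegral_ne_top hℓ.measurable_maxLoss hpos hneg
  have hfinite (i : Fin N) (k : Fin K) :
      ∀ᵐ x ∂μ i, x ∈ A k → ((maxLoss ℓ x).toReal : EReal) ≤ ℓ k x := by
    filter_upwards [(absolutelyContinuous_uniformMixture μ i).ae_le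
      (ae_ne_bot_of_lintegral_neg_ne_top hℓ.measurable_maxLoss hneg)] with x hbot hx
    rw [EReal.coe_toReal (hℓ.maxLoss_ne_top x) hbot, hargmax k x hx]
  rw [expect_eq_integral_toReal hℓ.measurable_maxLoss hℓ.maxLoss_ne_top hpos hneg]
  exact (integral_uniformMixture_le_objective_cellDecision hℓ.isConvexFunOn hℓ.isClosed hℓ.lsc
    hint_i hA hdisj hcover hmem (integrable_of_uniformMixture hloss) hfinite).trans <|
      le_iSup₂_of_le (cellDecision ξhat μ A) (cellDecision_mem_feasibleSet hN hℓ.convex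
        hℓ.isClosed hξ hint_i hmem hA hdisj hcover hε (hcost.trans_le hdist)) le_rfl

end UpperBound

section Main

variable {E : Type*} [NormedAddCommGroup E] [NormedSpace ℝ E] [CompleteSpace E]
  [SecondCountableTopology E] [MeasurableSpace E] [BorelSpace E] {N K : ℕ} {Ξ : Set E}
  {ξhat : Fin N → E} {ℓ : Fin K → E → EReal} {ε : ℝ}

theorem worstCaseExpectation_eq_programValue (hN : 0 < N) (hK : 0 < K) (hξ : ∀ i, ξhat i ∈ Ξ)
    (hℓ : ConvexityAssumption Ξ ℓ) (hε : 0 ≤ ε) :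
    worstCaseExpectation (wassersteinBall Ξ (empirical ξhat) ε) (maxLoss ℓ) =
      programValue Ξ ξhat ℓ ε :=
  le_antisymm (iSup₂_le fun _ hQ => expect_maxLoss_le_programValue hN hK hξ hℓ hε hQ) <|
    iSup₂_le fun d hd =>
      (objective_le_expect_inducedDistribution ξhat hN hd.2.2.1 fun _ _ =>
        hℓ.maxLoss_ne_top _).trans <|
      le_iSup₂_of_le (inducedDistribution ξhat d)
        (inducedDistribution_mem_wassersteinBall ξhat hN hd) le_rfl

theorem tendsto_expect_inducedDistribution (hN : 0 < N) (hK : 0 < K) (hξ : ∀ i, ξhat i ∈ Ξ)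
    (hℓ : ConvexityAssumption Ξ ℓ) (hε : 0 ≤ ε) {d : ℕ → Decision E N K}
    (hd : ∀ r, d r ∈ feasibleSet K Ξ ξhat ε)
    (hlim : Tendsto (fun r => objective ξhat ℓ (d r)) atTop (𝓝 (programValue Ξ ξhat ℓ ε))) :
    Tendsto (fun r => expect (inducedDistribution ξhat (d r)) (maxLoss ℓ)) atTop
      (𝓝 (worstCaseExpectation (wassersteinBall Ξ (empirical ξhat) ε) (maxLoss ℓ))) := by
  rw [worstCaseExpectation_eq_programValue hN hK hξ hℓ hε]
  exact tendsto_of_tendsto_of_tendsto_of_le_of_le hlim tendsto_const_nhds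
    (fun r => objective_le_expect_inducedDistribution ξhat hN (hd r).2.2.1 fun _ _ =>
      hℓ.maxLoss_ne_top _)
    (fun r => expect_maxLoss_le_programValue hN hK hξ hℓ hε
      (inducedDistribution_mem_wassersteinBall ξhat hN (hd r)))

end Main

end WassersteinDRO

open WassersteinDRO in
theorem mainTheorem2_general
    {E : Type*} [NormedAddCommGroup E] [NormedSpace ℝ E] [CompleteSpace E]
    [SecondCountableTopology E] [MeasurableSpace E] [BorelSpace E]
    {N K : ℕ} (hN : 0 < N) (hK : 0 < K)
    (Ξ : Set E) (ξhat : Fin N → E) (hξ : ∀ i, ξhat i ∈ Ξ)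
    (ℓ : Fin K → E → EReal) (hℓ : ConvexityAssumption Ξ ℓ)
    (ε : ℝ) (hε : 0 ≤ ε) :
    IsConvexFunOn (feasibleSet K Ξ ξhat ε) (fun d => -objective ξhat ℓ d) ∧
    worstCaseExpectation (wassersteinBall Ξ (empirical ξhat) ε) (maxLoss ℓ) =
      programValue Ξ ξhat ℓ ε ∧
    ∀ d : ℕ → Decision E N K, (∀ r, d r ∈ feasibleSet K Ξ ξhat ε) →
      Tendsto (fun r => objective ξhat ℓ (d r)) atTop (𝓝 (programValue Ξ ξhat ℓ ε)) →
      (∀ r, inducedDistribution ξhat (d r) ∈ wassersteinBall Ξ (empirical ξhat) ε) ∧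
      Tendsto (fun r => expect (inducedDistribution ξhat (d r)) (maxLoss ℓ)) atTop
        (𝓝 (worstCaseExpectation (wassersteinBall Ξ (empirical ξhat) ε) (maxLoss ℓ))) ∧
      Tendsto
        (fun r => (((N : ℝ)⁻¹ : ℝ) : EReal) *
          ∑ i, ∑ k, ((d r).1 i k : EReal) * maxLoss ℓ (atom ξhat (d r) i k)) atTop
        (𝓝 (worstCaseExpectation (wassersteinBall Ξ (empirical ξhat) ε) (maxLoss ℓ))) := by
  refine ⟨isConvexFunOn_neg_objective hℓ.convex hξ hℓ.isConvexFunOn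
    (fun k ξ _ => hℓ.ne_top k ξ) ε, worstCaseExpectation_eq_programValue hN hK hξ hℓ hε,
    fun d hd hlim => ?_⟩
  have hexpect := tendsto_expect_inducedDistribution hN hK hξ hℓ hε hd hlim
  exact ⟨fun r => inducedDistribution_mem_wassersteinBall ξhat hN (hd r), hexpect,
    hexpect.congr fun r => expect_inducedDistribution ξhat hN (hd r).2.2.1 fun _ _ =>
      hℓ.maxLoss_ne_top _⟩

theorem mainTheorem2
    {E : Type*} [NormedAddCommGroup E] [NormedSpace ℝ E] [FiniteDimensional ℝ E]
    [MeasurableSpace E] [BorelSpace E]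
    {N K : ℕ} (hN : 0 < N) (hK : 0 < K)
    (Ξ : Set E) (ξhat : Fin N → E) (hξ : ∀ i, ξhat i ∈ Ξ)
    (ℓ : Fin K → E → EReal) (hℓ : WassersteinDRO.ConvexityAssumption Ξ ℓ)
    (ε : ℝ) (hε : 0 ≤ ε) :
    -- the finite program is convex: concave objective over a convex feasible set
    WassersteinDRO.IsConvexFunOn (WassersteinDRO.feasibleSet K Ξ ξhat ε)
      (fun d => -WassersteinDRO.objective ξhat ℓ d) ∧
    -- its optimal value is the worst-case expectation
    WassersteinDRO.worstCaseExpectation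
        (WassersteinDRO.wassersteinBall Ξ (WassersteinDRO.empirical ξhat) ε)
        (WassersteinDRO.maxLoss ℓ) =
      WassersteinDRO.programValue Ξ ξhat ℓ ε ∧
    -- maximizing sequences induce asymptotically worst-case distributions
    ∀ d : ℕ → WassersteinDRO.Decision E N K,
      (∀ r, d r ∈ WassersteinDRO.feasibleSet K Ξ ξhat ε) →
      Tendsto (fun r => WassersteinDRO.objective ξhat ℓ (d r)) atTop
        (𝓝 (WassersteinDRO.programValue Ξ ξhat ℓ ε)) →
      (∀ r, WassersteinDRO.inducedDistribution ξhat (d r) ∈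
        WassersteinDRO.wassersteinBall Ξ (WassersteinDRO.empirical ξhat) ε) ∧
      Tendsto
        (fun r => WassersteinDRO.expect (WassersteinDRO.inducedDistribution ξhat (d r))
          (WassersteinDRO.maxLoss ℓ)) atTop
        (𝓝 (WassersteinDRO.worstCaseExpectation
          (WassersteinDRO.wassersteinBall Ξ (WassersteinDRO.empirical ξhat) ε)
          (WassersteinDRO.maxLoss ℓ))) ∧
      Tendsto
        (fun r => (((N : ℝ)⁻¹ : ℝ) : EReal) * ∑ i, ∑ k, ((d r).1 i k : EReal) *
          WassersteinDRO.maxLoss ℓ (WassersteinDRO.atom ξhat (d r) i k)) atTop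
        (𝓝 (WassersteinDRO.worstCaseExpectation
          (WassersteinDRO.wassersteinBall Ξ (WassersteinDRO.empirical ξhat) ε)
          (WassersteinDRO.maxLoss ℓ))) :=
  have := FiniteDimensional.complete ℝ E
  have := FiniteDimensional.proper ℝ E
  mainTheorem2_general hN hK Ξ ξhat hξ ℓ hℓ ε hε
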